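/- Let $H$ be a Hilbert space. For a maximal monotone linear operator $B$ on $H$, let $S_B=(S_B(t))_{t\ge 0}$ denote the strongly continuous semigroup of contractions on $H$ generated by $-B$, let $\mathsf D(B)$ be the domain of $B$, and let $B^k$ be the $k$-th power of $B$ with its natural domain $\mathsf D(B^k)$. Let $A$ and $G$ be linear maximal monotone operators on $H$, let $\varepsilon_0>0$, and assume that, for every $\varepsilon\in\,]0,\varepsilon_0]$, the closure of $A+\varepsilon G$ (defined on $\mathsf D(A)\cap\mathsf D(G)$), again denoted by $A+\varepsilon G$, is maximal monotone. Let $m\ge 1$ be an integer and let $\alpha_1,\ldots,\alpha_{m+1}$ be real constants such that, for every $k\in\{1,\ldots,m+1\}$, every $\phi\in\mathsf D(G^k)$ and every $t\ge 0$, one has $S_A(t)\phi\in\mathsf D(G^k)$ and \[ \|G^k S_A(t)\phi\|\le e^{\alpha_k t}\,\|G^k\phi\|. \] Then, for every $\varepsilon\in\,]0,\varepsilon_0]$, every $k\in\{1,\ldots,m+1\}$, every $\phi\in\mathsf D(G^k)$ and every $t\ge 0$, one has $S_{A+\varepsilon G}(t)\phi\in\mathsf D(G^k)$ and \[ \|G^k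 S_{A+\varepsilon G}(t)\phi\|\le e^{\alpha_k t}\,\|G^k\phi\|. \] -/

import Mathlib

open Filter Topology
open scoped NNReal RealInnerProductSpace

namespace LinearPMap

section Algebra

variable {H : Type*} [AddCommGroup H] [Module ℝ H]

/-- The composition `g ∘ f` of two operators with natural domain
`{x ∈ D(f) | f x ∈ D(g)}`. -/
def natComp (g f : H →ₗ.[ℝ] H) : H →ₗ.[ℝ] H where
  domain := (g.domain.comap f.toFun).map f.domain.subtype
  toFun :=
    { toFun := fun x =>
        g ⟨f ⟨x.1, by obtain ⟨y, -, hy⟩ := x.2; exact hy ▸ y.2⟩,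
          by obtain ⟨y, hy, hyx⟩ := x.2
             have h : (⟨x.1, hyx ▸ y.2⟩ : f.domain) = y := Subtype.ext hyx.symm
             rw [h]; exact hy⟩
      map_add' := fun x y => by
        rw [← g.map_add]
        congr 1
        apply Subtype.ext
        exact f.map_add ⟨x.1, _⟩ ⟨y.1, _⟩
      map_smul' := fun c x => by
        rw [RingHom.id_apply, ← g.map_smul]
        congr 1
        apply Subtype.ext
        exact f.map_smul c ⟨x.1, _⟩ }

theorem mem_natComp_domain {g f : H →ₗ.[ℝ] H} {x : H} :
    x ∈ (natComp g f).domain ↔ ∃ hx : x ∈ f.domain, f ⟨x, hx⟩ ∈ g.domain := by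
  constructor
  · rintro ⟨y, hy, rfl⟩
    exact ⟨y.2, hy⟩
  · rintro ⟨hx, hgx⟩
    exact ⟨⟨x, hx⟩, hgx, rfl⟩

/-- The powers of an operator: `G⁰` is the identity of `H`, and `Gᵏ⁺¹ = G ∘ Gᵏ` on
`D(Gᵏ⁺¹) = {x ∈ D(Gᵏ) | Gᵏ x ∈ D(G)}`. -/
def iter (G : H →ₗ.[ℝ] H) : ℕ → (H →ₗ.[ℝ] H)
  | 0 => (LinearMap.id : H →ₗ[ℝ] H).toPMap ⊤
  | k + 1 => natComp G (iter G k)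

end Algebra

section Hilbert

variable {H : Type*} [NormedAddCommGroup H] [InnerProductSpace ℝ H]

/-- A linear operator is monotone if its graph is a monotone subset of `H × H`
(for linear `A`: `0 ≤ ⟪x, A x⟫` on `D(A)`). -/
def IsMonotoneOp (A : H →ₗ.[ℝ] H) : Prop :=
  ∀ x y : A.domain, 0 ≤ ⟪(x : H) - y, A x - A y⟫

/-- A monotone linear operator is maximal monotone if its graph has no proper monotone
extension: every pair `(x, y)` that is monotonically related to the whole graph of `A`
belongs to that graph. -/
def IsMaximalMonotone (A : H →ₗ.[ℝ] H) : Prop :=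
  A.IsMonotoneOp ∧
    ∀ x y : H, (∀ z : A.domain, 0 ≤ ⟪x - z, y - A z⟫) → (x, y) ∈ A.graph

end Hilbert

end LinearPMap

/-- A strongly continuous semigroup of (linear) contractions on `H`. -/
structure ContractionSemigroup (H : Type*) [NormedAddCommGroup H] [InnerProductSpace ℝ H] where
  /-- The operators of the semigroup. -/
  op : ℝ≥0 → H →L[ℝ] H
  op_zero : op 0 = ContinuousLinearMap.id ℝ H
  op_add : ∀ s t, op (s + t) = (op s).comp (op t)
  continuous_orbit : ∀ x, Continuous fun t => op t x
  norm_op_le : ∀ t, ‖op t‖ ≤ 1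

/-- The operator `B` is the infinitesimal generator of `S`: `x ∈ D(B)` and `B x = y` if and only
if `(S(t) x - x) / t → y` in `H` as `t ↓ 0`. -/
def ContractionSemigroup.HasGenerator {H : Type*} [NormedAddCommGroup H] [InnerProductSpace ℝ H]
    (S : ContractionSemigroup H) (B : H →ₗ.[ℝ] H) : Prop :=
  ∀ x y : H, (x, y) ∈ B.graph ↔
    Tendsto (fun t : ℝ≥0 => (t : ℝ)⁻¹ • (S.op t x - x)) (𝓝[>] 0) (𝓝 y)

/-- For all `t ≥ 0` and all `φ ∈ D(T)`: `S(t) φ ∈ D(T)` and `‖T S(t) φ‖ ≤ exp (a t) ‖T φ‖`. -/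
def ContractionSemigroup.GrowthBoundOn {H : Type*} [NormedAddCommGroup H]
    [InnerProductSpace ℝ H] (S : ContractionSemigroup H) (T : H →ₗ.[ℝ] H) (a : ℝ) : Prop :=
  ∀ (φ : T.domain) (t : ℝ≥0), ∃ h : S.op t φ ∈ T.domain,
    ‖T ⟨S.op t φ, h⟩‖ ≤ Real.exp (a * t) * ‖T φ‖

/-! Each `k` is treated separately, with `T = G^k`. Everything rests on the lower semicontinuity of
`‖T x‖`, set to `∞` off the domain, in the form that all sets `T.sublevel a` are closed
(`isClosed_sublevel_iter`); membership and norm bound then pass to limits together.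

The one-step operators `V(h) = S_A(h) (1 + εhG)⁻¹` are contractions. The resolvent of `G` commutes
with `T`, so `V(h)` inherits the factor `e^{αh}` from `S_A(h)`; on `D(A) ∩ D(G)` it is tangent to
`-(A + εG)` at `h = 0` (`tendsto_op_resolvent`).

The resolvents of the bounded generators `(V(h) - 1)/h` are Neumann series, hence obey explicit
bounds. As `h → 0` they converge to the resolvent `(1 + l(A + εG))⁻¹`, which gets the factor `(1 -
lα)⁻¹` (`scales_of_tangent`). Exponentiating the Yosida approximations and letting `l → 0` turns
this into `e^{αt}` for the semigroup (`growthBoundOn_of_resolvent`). -/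

/-- In a Hilbert space, bounded operators map closed balls around the origin onto closed sets. -/
theorem ContinuousLinearMap.isClosed_image_closedBall {H : Type*} [NormedAddCommGroup H]
    [InnerProductSpace ℝ H] [CompleteSpace H] (Q : H →L[ℝ] H) (r : ℝ) :
    IsClosed (Q '' Metric.closedBall 0 r) := by
  have hK : IsCompact (WeakDual.toStrongDual ⁻¹' Metric.closedBall (0 : StrongDual ℝ H) r) :=
    WeakDual.isCompact_closedBall 0 r
  -- `F` is `Q` seen weakly: by Riesz and the adjoint, `Q y` is recorded as the function `z ↦ ⟪Q y,
  -- z⟫`, and the image of the weakly compact ball is compact.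
  let F : WeakDual ℝ H → (H → ℝ) := fun f z => f (ContinuousLinearMap.adjoint Q z)
  have hF : Continuous F := continuous_pi fun z => WeakDual.eval_continuous _
  have hcl := (hK.image hF).isClosed
  let E : H → (H → ℝ) := fun x z => ⟪x, z⟫
  have hE : Continuous E := continuous_pi fun z => by fun_prop
  convert hcl.preimage hE using 1
  ext x
  constructor
  · rintro ⟨y, hy, rfl⟩
    refine ⟨StrongDual.toWeakDual (InnerProductSpace.toDual ℝ H y), ?_, ?_⟩
    · simpa using hy
    · funext z
      exact (ContinuousLinearMap.adjoint_inner_right Q y z)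
  · rintro ⟨f, hf, hfx⟩
    refine ⟨(InnerProductSpace.toDual ℝ H).symm (WeakDual.toStrongDual f), ?_, ?_⟩
    · simpa using hf
    · refine ext_inner_right ℝ fun z => ?_
      rw [← ContinuousLinearMap.adjoint_inner_right, InnerProductSpace.toDual_symm_apply]
      exact congrFun hfx z

/-! ### Powers of an operator, resolvents, Minty's theorem. -/

namespace LinearPMap

section Algebra

variable {H : Type*} [AddCommGroup H] [Module ℝ H]

theorem mem_graph_iter_zero {G : H →ₗ.[ℝ] H} {x y : H} :
    (x, y) ∈ (G.iter 0).graph ↔ x = y := by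
  simp [iter, mem_graph_iff]

theorem mem_graph_iter_succ {G : H →ₗ.[ℝ] H} {k : ℕ} {x y : H} :
    (x, y) ∈ (G.iter (k + 1)).graph ↔ ∃ z, (x, z) ∈ (G.iter k).graph ∧ (z, y) ∈ G.graph := by
  constructor
  · intro h
    obtain ⟨⟨w, hw⟩, h1, h2⟩ := (mem_graph_iff _).1 h
    obtain ⟨hx, hgx⟩ := mem_natComp_domain.1 hw
    simp only at h1
    subst h1
    refine ⟨iter G k ⟨w, hx⟩, mem_graph _ ⟨w, hx⟩, ?_⟩
    simp only at h2
    rw [← h2]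
    exact mem_graph G ⟨_, hgx⟩
  · rintro ⟨z, h1, h2⟩
    obtain ⟨⟨w, hw⟩, rfl, rfl⟩ := (mem_graph_iff _).1 h1
    obtain ⟨⟨v, hv⟩, h3, rfl⟩ := (mem_graph_iff _).1 h2
    simp only at h3
    subst h3
    exact mem_graph (iter G (k + 1)) ⟨w, mem_natComp_domain.2 ⟨hw, hv⟩⟩

theorem mem_graph_neg {G : H →ₗ.[ℝ] H} {x y : H} :
    (x, y) ∈ (-G).graph ↔ (x, -y) ∈ G.graph := by
  constructor
  · intro h
    obtain ⟨z, rfl, rfl⟩ := (mem_graph_iff _).1 h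
    rw [neg_apply, neg_neg]
    exact mem_graph G z
  · intro h
    obtain ⟨z, rfl, hz⟩ := (mem_graph_iff _).1 h
    simp only at hz
    rw [← neg_neg y, ← hz]
    exact mem_graph (-G) z

theorem exists_of_mem_graph_add {A G : H →ₗ.[ℝ] H} {x y : H} (h : (x, y) ∈ (A + G).graph) :
    ∃ a g, (x, a) ∈ A.graph ∧ (x, g) ∈ G.graph ∧ y = a + g := by
  obtain ⟨⟨z, hz⟩, rfl, rfl⟩ := (mem_graph_iff _).1 h
  exact ⟨A ⟨z, hz.1⟩, G ⟨z, hz.2⟩, mem_graph A ⟨z, hz.1⟩, mem_graph G ⟨z, hz.2⟩, rfl⟩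

theorem exists_of_mem_graph_smul {G : H →ₗ.[ℝ] H} {c : ℝ} {x y : H}
    (h : (x, y) ∈ (c • G).graph) : ∃ g, (x, g) ∈ G.graph ∧ y = c • g := by
  obtain ⟨z, rfl, rfl⟩ := (mem_graph_iff _).1 h
  exact ⟨_, mem_graph G z, rfl⟩

/-- A linear map that leaves the graph of `G` invariant leaves the graphs of its powers
invariant. -/
theorem map_mem_graph_iter {G : H →ₗ.[ℝ] H} {J : H → H}
    (hJ : ∀ x y, (x, y) ∈ G.graph → (J x, J y) ∈ G.graph) (k : ℕ) :
    ∀ {x y : H}, (x, y) ∈ (G.iter k).graph → (J x, J y) ∈ (G.iter k).graph := by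
  induction k with
  | zero =>
    intro x y h
    rw [mem_graph_iter_zero] at h ⊢
    rw [h]
  | succ k ih =>
    intro x y h
    obtain ⟨z, h1, h2⟩ := mem_graph_iter_succ.1 h
    exact mem_graph_iter_succ.2 ⟨J z, ih h1, hJ _ _ h2⟩

end Algebra

/-- For non-closable `B`, `B.closure` is `B` by convention, so the inclusion holds in every case. It
lets points of the closure be approximated from the graph of `B`. -/
theorem graph_closure_le {H : Type*} [NormedAddCommGroup H] [NormedSpace ℝ H] (B : H →ₗ.[ℝ] H) :
    (B.closure.graph : Set (H × H)) ⊆ _root_.closure B.graph := by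
  by_cases hB : B.IsClosable
  · rw [← hB.graph_closure_eq_closure_graph, Submodule.topologicalClosure_coe]
  · rw [closure_def' hB]
    exact subset_closure

section Hilbert

variable {H : Type*} [NormedAddCommGroup H] [InnerProductSpace ℝ H]

theorem IsMonotoneOp.inner_nonneg {B : H →ₗ.[ℝ] H} (hB : B.IsMonotoneOp) {x y : H}
    (h : (x, y) ∈ B.graph) : 0 ≤ ⟪x, y⟫ := by
  obtain ⟨z, rfl, rfl⟩ := (mem_graph_iff _).1 h
  simpa using hB z 0

theorem IsMaximalMonotone.mem_graph {B : H →ₗ.[ℝ] H} (hB : B.IsMaximalMonotone) {x y : H}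
    (h : ∀ u v, (u, v) ∈ B.graph → 0 ≤ ⟪x - u, y - v⟫) : (x, y) ∈ B.graph :=
  hB.2 x y fun z => h _ _ (LinearPMap.mem_graph B z)

theorem IsMaximalMonotone.isClosed_graph {B : H →ₗ.[ℝ] H} (hB : B.IsMaximalMonotone) :
    _root_.IsClosed (B.graph : Set (H × H)) := by
  have : (B.graph : Set (H × H)) = ⋂ z : B.domain, {p : H × H | 0 ≤ ⟪p.1 - z, p.2 - B z⟫} := by
    ext ⟨x, y⟩
    simp only [SetLike.mem_coe, Set.mem_iInter, Set.mem_ofPred_eq]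
    refine ⟨fun h z => ?_, hB.2 x y⟩
    obtain ⟨w, rfl, rfl⟩ := (mem_graph_iff _).1 h
    exact hB.1 w z
  rw [this]
  exact isClosed_iInter fun z => isClosed_le continuous_const (by fun_prop)

/-- `J` is the resolvent `(1 + l B)⁻¹`. -/
structure IsResolvent (B : H →ₗ.[ℝ] H) (l : ℝ) (J : H →L[ℝ] H) : Prop where
  mem_graph : ∀ x, (J x, l⁻¹ • (x - J x)) ∈ B.graph
  apply_add : ∀ {x y}, (x, y) ∈ B.graph → J (x + l • y) = x
  norm_le : ‖J‖ ≤ 1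

namespace IsResolvent

variable {B : H →ₗ.[ℝ] H} {l : ℝ} {J : H →L[ℝ] H}

theorem norm_apply_le (h : IsResolvent B l J) (x : H) : ‖J x‖ ≤ ‖x‖ := by
  simpa using J.le_of_opNorm_le h.norm_le x

theorem sub_apply (h : IsResolvent B l J) {x y : H} (hxy : (x, y) ∈ B.graph) :
    x - J x = l • J y := by
  have := h.apply_add hxy
  rw [_root_.map_add, _root_.map_smul] at this
  nth_rw 1 [← this]
  abel

theorem apply_mem_graph (h : IsResolvent B l J) (hl : l ≠ 0) {x y : H} (hxy : (x, y) ∈ B.graph) :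
    (J x, J y) ∈ B.graph := by
  have := h.mem_graph x
  rwa [h.sub_apply hxy, smul_smul, inv_mul_cancel₀ hl, one_smul] at this

theorem mem_graph_of_eq (h : IsResolvent B l J) (hl : l ≠ 0) {x y : H}
    (hxy : x - J x = l • J y) : (x, y) ∈ B.graph := by
  have h1 : x = J (x + l • y) := by
    rw [_root_.map_add, _root_.map_smul, ← hxy]; abel
  have h2 := h.mem_graph (x + l • y)
  rw [← h1, add_sub_cancel_left, smul_smul, inv_mul_cancel₀ hl, one_smul] at h2
  exact h2

theorem injective (h : IsResolvent B l J) (hl : l ≠ 0) : Function.Injective J := by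
  refine (injective_iff_map_eq_zero J).2 fun x hx => ?_
  have h2 := h.mem_graph x
  rw [hx, sub_zero] at h2
  have := B.graph_fst_eq_zero_snd h2 rfl
  simpa [hl] using this

/-- Graphs of powers in terms of the resolvent. -/
theorem mem_graph_iter_iff (h : IsResolvent B 1 J) (k : ℕ) {x y : H} :
    (x, y) ∈ (B.iter k).graph ↔ ((1 - J) ^ k) x = (J ^ k) y := by
  have hc : Commute (1 - J) J := (Commute.one_left J).sub_left (Commute.refl J)
  have hinj : ∀ k : ℕ, Function.Injective (J ^ k : H →L[ℝ] H) := by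
    intro k
    rw [FunLike.coe_pow_eq_iterate]
    exact (h.injective one_ne_zero).iterate k
  induction k generalizing x y with
  | zero => rw [mem_graph_iter_zero]; simp
  | succ k ih =>
    rw [mem_graph_iter_succ]
    constructor
    · rintro ⟨z, h1, h2⟩
      replace h1 := ih.1 h1
      have h3 := h.sub_apply h2
      rw [one_smul] at h3
      have h3' : (1 - J) z = J y := by simpa using h3
      rw [pow_succ', mul_apply_eq_comp, h1, ← mul_apply_eq_comp, (hc.pow_right k).eq, mul_apply_eq_comp,
        h3', ← mul_apply_eq_comp, pow_succ]
    · intro hxy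
      -- The Bézout identity, evaluated at `J`, puts `x` in the range of `J ^ k`, because `(1 -
      -- J)^(k+1) x = J^(k+1) y` already lies there.
      have hcop : IsCoprime ((1 - Polynomial.X : Polynomial ℝ) ^ (k + 1)) (Polynomial.X ^ k) :=
        IsCoprime.pow ⟨1, 1, by ring⟩
      obtain ⟨a, b, hab⟩ := hcop
      have hab' := congrArg (Polynomial.aeval J) hab
      simp only [_root_.map_add, map_mul, map_pow, _root_.map_sub, map_one, Polynomial.aeval_X] at hab'
      set a' := Polynomial.aeval J a
      set b' := Polynomial.aeval J b
      have hcomm : ∀ p : Polynomial ℝ, Commute (Polynomial.aeval J p) J := fun p => by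
        have := (Commute.all p Polynomial.X).map (Polynomial.aeval J)
        rwa [Polynomial.aeval_X] at this
      have ha : Commute a' J := hcomm a
      have hb : Commute b' J := hcomm b
      obtain ⟨w, rfl⟩ : ∃ w, x = (J ^ k) w := by
        refine ⟨a' (J y) + b' x, ?_⟩
        have hx : x = (a' * (1 - J) ^ (k + 1) + b' * J ^ k) x := by rw [hab']; rfl
        nth_rw 1 [hx]
        rw [_root_.add_apply, mul_apply_eq_comp, hxy, pow_succ, mul_apply_eq_comp, ← mul_apply_eq_comp a',
          (ha.pow_right k).eq, (hb.pow_right k).eq, _root_.map_add]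
        rfl
      refine ⟨((1 - J) ^ k) w, ?_, ?_⟩
      · refine ih.2 ?_
        rw [← mul_apply_eq_comp, ((hc.pow_pow k k)).eq]
        rfl
      · refine h.mem_graph_of_eq one_ne_zero ?_
        rw [one_smul]
        apply hinj k
        have h4 : ((1 - J) ^ (k + 1) * J ^ k) w = (J ^ k * J) y := by
          rw [← pow_succ]; exact hxy
        rw [(hc.pow_pow (k + 1) k).eq, pow_succ'] at h4
        simpa using h4

end IsResolvent

/-- Minty's theorem for linear operators. -/
theorem IsMaximalMonotone.exists_isResolvent [CompleteSpace H] {B : H →ₗ.[ℝ] H}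
    (hB : B.IsMaximalMonotone) {l : ℝ} (hl : 0 < l) : ∃ J, IsResolvent B l J := by
  let Φ : B.graph →L[ℝ] H :=
    (ContinuousLinearMap.fst ℝ H H + l • ContinuousLinearMap.snd ℝ H H).comp B.graph.subtypeL
  have hΦ : ∀ p : B.graph, Φ p = p.1.1 + l • p.1.2 := fun p => rfl
  -- Monotonicity makes the cross term nonnegative, so `Φ` is bounded below and its range is closed.
  have hsq : ∀ p : B.graph, ‖p.1.1‖ ^ 2 + (l * ‖p.1.2‖) ^ 2 ≤ ‖Φ p‖ ^ 2 := by
    intro p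
    have h0 : 0 ≤ ⟪p.1.1, p.1.2⟫ := hB.1.inner_nonneg p.2
    rw [hΦ, norm_add_sq_real, real_inner_smul_right, norm_smul, Real.norm_of_nonneg hl.le]
    nlinarith [mul_nonneg hl.le h0]
  have hfst : ∀ p : B.graph, ‖p.1.1‖ ≤ ‖Φ p‖ := fun p =>
    abs_le_of_sq_le_sq' (by nlinarith [hsq p, sq_nonneg (l * ‖p.1.2‖)]) (norm_nonneg _) |>.2
  have hsnd : ∀ p : B.graph, l * ‖p.1.2‖ ≤ ‖Φ p‖ := fun p =>
    abs_le_of_sq_le_sq' (by nlinarith [hsq p, sq_nonneg (‖p.1.1‖)]) (norm_nonneg _) |>.2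
  have hanti : AntilipschitzWith (Real.toNNReal (max 1 l⁻¹)) Φ := by
    refine ContinuousLinearMap.antilipschitz_of_bound _ fun p => ?_
    rw [Real.coe_toNNReal _ (by positivity)]
    change max ‖p.1.1‖ ‖p.1.2‖ ≤ _
    refine max_le ?_ ?_
    · exact (hfst p).trans (le_mul_of_one_le_left (norm_nonneg _) (le_max_left _ _))
    · calc ‖p.1.2‖ = l⁻¹ * (l * ‖p.1.2‖) := by field_simp
        _ ≤ l⁻¹ * ‖Φ p‖ := by gcongr; exact hsnd p
        _ ≤ _ := by gcongr; exact le_max_right _ _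
  have : CompleteSpace B.graph := hB.isClosed_graph.completeSpace_coe
  have hrange : _root_.IsClosed (Set.range Φ) := hanti.isClosed_range Φ.uniformContinuous
  have hsurj : Φ.range = ⊤ := by
    have : CompleteSpace Φ.range := hrange.completeSpace_coe
    rw [← Submodule.orthogonal_eq_bot_iff, Submodule.eq_bot_iff]
    intro u hu
    have hu' : ∀ x y, (x, y) ∈ B.graph → ⟪u, x⟫ + l * ⟪u, y⟫ = 0 := by
      intro x y hxy
      have := (Submodule.mem_orthogonal' _ _).1 hu (Φ ⟨(x, y), hxy⟩) ⟨_, rfl⟩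
      rwa [hΦ, inner_add_right, real_inner_smul_right] at this
    -- For `u` orthogonal to the range, `⟪u - x, l⁻¹ u - y⟫ = l⁻¹‖u‖² + ⟪x, y⟫ ≥ 0`. Maximality
    -- applies, and then `u` is orthogonal to `u + l (l⁻¹ u) = 2u`.
    have hmem : (u, l⁻¹ • u) ∈ B.graph := by
      refine hB.mem_graph fun x y hxy => ?_
      have h1 := hu' x y hxy
      have h2 := hB.1.inner_nonneg hxy
      have h3 : ⟪u, y⟫ = - (l⁻¹ * ⟪u, x⟫) := by field_simp; linarith
      rw [inner_sub_left, inner_sub_right, inner_sub_right, real_inner_smul_right,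
        real_inner_smul_right, h3, real_inner_comm u x]
      have : 0 ≤ l⁻¹ * ⟪u, u⟫ := mul_nonneg (inv_nonneg.2 hl.le) real_inner_self_nonneg
      linarith
    have := hu' _ _ hmem
    rw [real_inner_smul_right, ← mul_assoc, mul_inv_cancel₀ hl.ne', one_mul] at this
    exact inner_self_eq_zero.1 (by linarith : ⟪u, u⟫ = 0)
  let e : B.graph ≃ₗ[ℝ] H := LinearEquiv.ofBijective (Φ : B.graph →ₗ[ℝ] H)
    ⟨hanti.injective, LinearMap.range_eq_top.1 hsurj⟩
  have he : ∀ p, e p = Φ p := fun p => rfl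
  let J : H →L[ℝ] H := LinearMap.mkContinuous
    ((LinearMap.fst ℝ H H).comp (B.graph.subtype.comp (e.symm : H →ₗ[ℝ] B.graph))) 1 (by
      intro x
      rw [one_mul]
      have := hfst (e.symm x)
      rwa [← he, e.apply_symm_apply] at this)
  have hJ : ∀ x, J x = (e.symm x).1.1 := fun x => rfl
  refine ⟨J, ?_, ?_, LinearMap.mkContinuous_norm_le _ zero_le_one _⟩
  · intro x
    have h1 : Φ (e.symm x) = x := e.apply_symm_apply x
    rw [hΦ] at h1
    have h2 : l⁻¹ • (x - J x) = (e.symm x).1.2 := by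
      rw [hJ]
      nth_rw 1 [← h1]
      rw [add_sub_cancel_left, smul_smul, inv_mul_cancel₀ hl.ne', one_smul]
    rw [h2, hJ]
    exact (e.symm x).2
  · intro x y hxy
    have : e.symm (x + l • y) = ⟨(x, y), hxy⟩ := by
      rw [LinearEquiv.symm_apply_eq]; rfl
    rw [hJ, this]

end Hilbert

end LinearPMap

/-! ### Closed sublevel sets and operators that scale them. -/

namespace LinearPMap

variable {H : Type*} [NormedAddCommGroup H] [InnerProductSpace ℝ H]

/-- The elements `x` of the domain of `T` with `‖T x‖ ≤ a`. -/
def sublevel (T : H →ₗ.[ℝ] H) (a : ℝ) : Set H := {x | ∃ y, (x, y) ∈ T.graph ∧ ‖y‖ ≤ a}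

section sublevel

variable {T : H →ₗ.[ℝ] H} {a b : ℝ} {x y : H}

theorem sublevel_mono (hab : a ≤ b) : T.sublevel a ⊆ T.sublevel b :=
  fun _ ⟨y, hy, hya⟩ => ⟨y, hy, hya.trans hab⟩

theorem nonneg_of_mem_sublevel (hx : x ∈ T.sublevel a) : 0 ≤ a := by
  obtain ⟨y, -, hy⟩ := hx
  exact (norm_nonneg y).trans hy

theorem zero_mem_sublevel : (0 : H) ∈ T.sublevel 0 := ⟨0, T.graph.zero_mem, norm_zero.le⟩

theorem add_mem_sublevel (hx : x ∈ T.sublevel a) (hy : y ∈ T.sublevel b) :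
    x + y ∈ T.sublevel (a + b) := by
  obtain ⟨u, hu, hua⟩ := hx
  obtain ⟨v, hv, hvb⟩ := hy
  exact ⟨u + v, T.graph.add_mem hu hv, norm_add_le_of_le hua hvb⟩

theorem smul_mem_sublevel {c : ℝ} (hc : 0 ≤ c) (hx : x ∈ T.sublevel a) :
    c • x ∈ T.sublevel (c * a) := by
  obtain ⟨u, hu, hua⟩ := hx
  refine ⟨c • u, T.graph.smul_mem c hu, ?_⟩
  rw [norm_smul, Real.norm_of_nonneg hc]
  gcongr

theorem sum_mem_sublevel {f : ℕ → H} {b : ℕ → ℝ} (hf : ∀ n, f n ∈ T.sublevel (b n))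
    (s : Finset ℕ) : ∑ n ∈ s, f n ∈ T.sublevel (∑ n ∈ s, b n) := by
  induction s using Finset.cons_induction with
  | empty => simpa using zero_mem_sublevel
  | cons n s hn ih =>
    rw [Finset.sum_cons, Finset.sum_cons]
    exact add_mem_sublevel (hf n) ih

/-- The bounds `b n` are nonnegative, so every partial sum already lies in the closed set
`T.sublevel a`. -/
theorem hasSum_mem_sublevel (hT : ∀ a, _root_.IsClosed (T.sublevel a)) {f : ℕ → H} {b : ℕ → ℝ}
    (hf : ∀ n, f n ∈ T.sublevel (b n)) (hx : HasSum f x) (ha : HasSum b a) :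
    x ∈ T.sublevel a :=
  (hT a).mem_of_tendsto hx <| Eventually.of_forall fun s =>
    sublevel_mono (sum_le_hasSum s (fun n _ => nonneg_of_mem_sublevel (hf n)) ha)
      (sum_mem_sublevel hf s)

theorem mem_sublevel_of_tendsto (hT : ∀ a, _root_.IsClosed (T.sublevel a)) {ι : Type*}
    {p : Filter ι} [p.NeBot] {f : ι → H} {b : ι → ℝ} (hf : ∀ᶠ i in p, f i ∈ T.sublevel (b i))
    (hx : Tendsto f p (𝓝 x)) (ha : Tendsto b p (𝓝 a)) : x ∈ T.sublevel a := by
  have key : ∀ d, a < d → x ∈ T.sublevel d := fun d hd =>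
    (hT d).mem_of_tendsto hx <| by
      filter_upwards [hf, ha.eventually_lt_const hd] with i hi hid
      exact sublevel_mono hid.le hi
  -- Any level above `a` yields the value `y` of `T` at `x`; since `T` is single-valued, the same
  -- `y` satisfies all the bounds `d > a`.
  obtain ⟨y, hy, -⟩ := key (a + 1) (by linarith)
  refine ⟨y, hy, le_of_forall_gt_imp_ge_of_dense fun d hd => ?_⟩
  obtain ⟨z, hz, hzd⟩ := key d hd
  rwa [T.mem_graph_snd_inj hy hz rfl]

end sublevel

/-- The sublevel sets of the powers of a maximal monotone operator are closed. -/
theorem IsMaximalMonotone.isClosed_sublevel_iter [CompleteSpace H] {G : H →ₗ.[ℝ] H}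
    (hG : G.IsMaximalMonotone) (k : ℕ) (a : ℝ) : _root_.IsClosed ((G.iter k).sublevel a) := by
  obtain ⟨J, hJ⟩ := hG.exists_isResolvent one_pos
  -- The sublevel set consists of the `x` with `(1 - J)^k x ∈ J^k (ball)`.
  convert ((J ^ k).isClosed_image_closedBall a).preimage ((1 - J) ^ k).continuous using 1
  ext x
  constructor
  · rintro ⟨y, hy, hya⟩
    exact ⟨y, by simpa using hya, ((hJ.mem_graph_iter_iff k).1 hy).symm⟩
  · rintro ⟨y, hya, hy⟩
    exact ⟨y, (hJ.mem_graph_iter_iff k).2 hy.symm, by simpa using hya⟩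

/-- The map `U` preserves the domain of `T`, and `‖T (U x)‖ ≤ r ‖T x‖` there. -/
def Scales (T : H →ₗ.[ℝ] H) (U : H → H) (r : ℝ) : Prop :=
  ∀ ⦃a : ℝ⦄ ⦃x : H⦄, x ∈ T.sublevel a → U x ∈ T.sublevel (r * a)

theorem Scales.comp {T : H →ₗ.[ℝ] H} {U V : H → H} {r s : ℝ} (hU : Scales T U r)
    (hV : Scales T V s) : Scales T (fun x => U (V x)) (r * s) := fun a x hx => by
  rw [mul_assoc]
  exact hU (hV hx)

theorem Scales.pow {T : H →ₗ.[ℝ] H} {V : H →L[ℝ] H} {r : ℝ} (hV : Scales T V r) (n : ℕ) :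
    Scales T (V ^ n : H →L[ℝ] H) (r ^ n) := by
  induction n with
  | zero => intro a x hx; simpa using hx
  | succ n ih =>
    rw [_root_.pow_succ, _root_.pow_succ]
    exact ih.comp hV

theorem IsResolvent.scales_iter {G : H →ₗ.[ℝ] H} {l : ℝ} {J : H →L[ℝ] H}
    (hJ : IsResolvent G l J) (hl : l ≠ 0) (k : ℕ) : Scales (G.iter k) J 1 := by
  rintro a x ⟨y, hy, hya⟩
  rw [one_mul]
  exact ⟨J y, map_mem_graph_iter (fun _ _ h => hJ.apply_mem_graph hl h) k hy,
    (hJ.norm_apply_le y).trans hya⟩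

/-! ### Resolvents of difference quotients and their limit. -/

/-- The resolvent equation of the generator `c (V - 1)`, `V` a contraction, is solved by a
Neumann series. -/
theorem exists_resolvent_of_contraction [CompleteSpace H] {T : H →ₗ.[ℝ] H}
    (hT : ∀ a, _root_.IsClosed (T.sublevel a)) {V : H →L[ℝ] H} (hV : ‖V‖ ≤ 1) {r c : ℝ}
    (hr : 0 ≤ r) (hVr : Scales T V r) (hc : 0 < c) (hcr : c * (r - 1) < 1) {a : ℝ} {y : H}
    (hy : y ∈ T.sublevel a) :
    ∃ u ∈ T.sublevel ((1 - c * (r - 1))⁻¹ * a), u + c • (u - V u) = y := by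
  have hc1 : 0 < 1 + c := by linarith
  -- The equation reads `(1 - d V) u = (1 + c)⁻¹ y`. Since `(1 + c)(1 - d r) = 1 - c (r - 1)`, the
  -- assumption `hcr` says exactly that `d r < 1`.
  set d := c / (1 + c) with hd
  have hd0 : 0 < d := div_pos hc hc1
  have hd1 : d < 1 := (div_lt_one hc1).2 (by linarith)
  have hq : ‖d • V‖ < 1 := by
    rw [norm_smul, Real.norm_of_nonneg hd0.le]
    nlinarith [norm_nonneg V]
  have hsum : HasSum (fun n => (1 + c)⁻¹ • ((d • V) ^ n) y)
      ((1 + c)⁻¹ • (∑' n, (d • V) ^ n) y) :=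
    ((ContinuousLinearMap.apply ℝ H y).hasSum
      (summable_geometric_of_norm_lt_one hq).hasSum).const_smul _
  have hdr : d * r < 1 := by
    rw [hd, div_mul_eq_mul_div, div_lt_one hc1]; linarith
  refine ⟨(1 + c)⁻¹ • (∑' n, (d • V) ^ n) y, ?_, ?_⟩
  · refine hasSum_mem_sublevel hT (b := fun n => (1 + c)⁻¹ * ((d * r) ^ n * a)) (fun n => ?_) hsum ?_
    · refine smul_mem_sublevel (inv_nonneg.2 hc1.le) ?_
      rw [_root_.smul_pow, _root_.mul_pow, _root_.mul_assoc]
      exact smul_mem_sublevel (pow_nonneg hd0.le n) (hVr.pow n hy)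
    · have := ((hasSum_geometric_of_lt_one (by positivity) hdr).mul_right a).mul_left (1 + c)⁻¹
      have he : (1 - c * (r - 1))⁻¹ * a = (1 + c)⁻¹ * ((1 - d * r)⁻¹ * a) := by
        rw [← _root_.mul_assoc, ← mul_inv]
        congr 2
        rw [hd]; field_simp; ring
      rwa [he]
  · have h1 : (1 - d • V) ((∑' n, (d • V) ^ n) y) = y := by
      rw [← mul_apply_eq_comp, mul_neg_geom_series _ hq]; rfl
    generalize (∑' n, (d • V) ^ n) y = w at h1
    have h2 : w - d • V w = y := h1
    rw [← h2, _root_.map_smul, hd]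
    have h3 : c / (1 + c) = c * (1 + c)⁻¹ := rfl
    have h4 : w = ((1 + c) * (1 + c)⁻¹) • w := by rw [mul_inv_cancel₀ hc1.ne', one_smul]
    nth_rw 4 [h4]
    module

/-- If the contractions `V h` are tangent to `-B` at `h = 0`, their growth bounds pass to the
resolvents of the closure of `B`. -/
theorem IsResolvent.scales_of_tangent [CompleteSpace H] {T B : H →ₗ.[ℝ] H}
    (hT : ∀ a, _root_.IsClosed (T.sublevel a)) {V : ℝ → H →L[ℝ] H} (hV : ∀ h, 0 < h → ‖V h‖ ≤ 1)
    {α : ℝ} (hVα : ∀ h, 0 < h → Scales T (V h) (Real.exp (α * h)))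
    (htan : ∀ x y, (x, y) ∈ B.graph →
      Tendsto (fun h : ℝ => h⁻¹ • (V h x - x)) (𝓝[>] 0) (𝓝 (-y)))
    {l : ℝ} (hl : 0 < l) (hlα : l * α < 1) {J : H →L[ℝ] H} (hJ : IsResolvent B.closure l J) :
    Scales T J (1 - l * α)⁻¹ := by
  intro a y hy
  -- The generator `(V h - 1)/h` with parameter `l` corresponds to `c = l / h` and `r = e^{αh}`.
  have hlim : Tendsto (fun h : ℝ => l / h * (Real.exp (α * h) - 1)) (𝓝[>] 0) (𝓝 (l * α)) := by
    have h1 : HasDerivAt (fun h : ℝ => Real.exp (α * h)) α 0 := by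
      simpa using ((hasDerivAt_id (0 : ℝ)).const_mul α).exp
    have h2 := (h1.tendsto_slope_zero_right).const_mul l
    refine h2.congr fun h => ?_
    simp [div_eq_mul_inv, mul_assoc]
  have hex : ∀ᶠ h : ℝ in 𝓝[>] 0, ∃ u ∈ T.sublevel ((1 - l / h * (Real.exp (α * h) - 1))⁻¹ * a),
      u + (l / h) • (u - V h u) = y := by
    filter_upwards [hlim.eventually_lt_const hlα, self_mem_nhdsWithin] with h h1 h2
    exact exists_resolvent_of_contraction hT (hV h h2) (Real.exp_pos _).le (hVα h h2)
      (div_pos hl h2) h1 hy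
  obtain ⟨u, hu⟩ := hex.choice
  refine mem_sublevel_of_tendsto hT (hu.mono fun h hh => hh.1) ?_
    (((hlim.const_sub 1).inv₀ (by linarith)).mul_const a)
  rw [Metric.tendsto_nhds]
  intro e he
  -- approximate the resolvent by an element of the graph of `B`
  have hmem := graph_closure_le B (hJ.mem_graph y)
  set w := l⁻¹ • (y - J y) with hw
  have hyw : y = J y + l • w := by
    rw [hw, smul_smul, mul_inv_cancel₀ hl.ne', one_smul]; abel
  -- With `δ = e / (2 (2 + l))` the two errors below are `δ (1 + l)` and `δ`, in total `e / 2`.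
  obtain ⟨⟨x', w'⟩, hxw, hdist⟩ := Metric.mem_closure_iff.1 hmem (e / (2 * (2 + l))) (by positivity)
  rw [Prod.dist_eq, max_lt_iff] at hdist
  obtain ⟨hd1, hd2⟩ := hdist
  rw [dist_eq_norm] at hd1 hd2
  have hlim2 : Tendsto (fun h : ℝ => ‖y - x' + l • (h⁻¹ • (V h x' - x'))‖) (𝓝[>] 0)
      (𝓝 ‖y - x' + l • (-w')‖) :=
    (((htan x' w' hxw).const_smul l).const_add _).norm
  have hsmall : ‖y - x' + l • (-w')‖ < e / (2 * (2 + l)) * (1 + l) := by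
    have : y - x' + l • (-w') = (J y - x') + l • (w - w') := by
      nth_rw 1 [hyw]; module
    rw [this]
    calc _ ≤ ‖J y - x'‖ + l * ‖w - w'‖ := by
          refine (norm_add_le _ _).trans_eq ?_
          rw [norm_smul, Real.norm_of_nonneg hl.le]
      _ < e / (2 * (2 + l)) + l * (e / (2 * (2 + l))) := by gcongr
      _ = _ := by ring
  filter_upwards [hu, hlim2.eventually_lt_const hsmall, self_mem_nhdsWithin] with h h1 h2 h3
  have h3 : 0 < h := h3
  have hlh : 0 < l / h := div_pos hl h3
  -- the approximate resolvents are contractions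
  have hest : ‖u h - x'‖ ≤ ‖y - x' + l • (h⁻¹ • (V h x' - x'))‖ := by
    have heq : (1 + l / h) • (u h - x') =
        (y - x' + l • (h⁻¹ • (V h x' - x'))) + (l / h) • V h (u h - x') := by
      rw [← h1.2, _root_.map_sub, smul_smul, ← div_eq_mul_inv]
      module
    have hn := congrArg norm heq
    rw [norm_smul, Real.norm_of_nonneg (by positivity)] at hn
    have h4 : ‖(l / h) • V h (u h - x')‖ ≤ l / h * ‖u h - x'‖ := by
      rw [norm_smul, Real.norm_of_nonneg hlh.le]
      have := (V h).le_of_opNorm_le (hV h h3) (u h - x')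
      rw [one_mul] at this
      gcongr
    have h5 := norm_add_le (y - x' + l • (h⁻¹ • (V h x' - x'))) ((l / h) • V h (u h - x'))
    rw [← hn] at h5
    linarith
  rw [dist_eq_norm]
  calc ‖u h - J y‖ ≤ ‖u h - x'‖ + ‖J y - x'‖ := by
        rw [← norm_neg (J y - x'), neg_sub]
        exact norm_sub_le_norm_sub_add_norm_sub _ _ _
    _ < e / (2 * (2 + l)) * (1 + l) + e / (2 * (2 + l)) :=
        add_lt_add (hest.trans_lt h2) hd1
    _ = e / 2 := by field_simp; ring
    _ < e := by linarith

end LinearPMap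

/-! ### Exponentials of `r (J - 1)` for a contraction `J`. -/

namespace NormedSpace

variable {E : Type*} [NormedAddCommGroup E] [NormedSpace ℝ E] [CompleteSpace E]

/-- For `r ≥ 0` this exhibits the exponential as a Poisson average of the powers of `J`; the weights
`e^{-r} r^n / n!` are nonnegative with sum 1. -/
theorem exp_smul_sub_one (J : E →L[ℝ] E) (r : ℝ) :
    NormedSpace.exp (r • (J - 1)) = Real.exp (-r) • NormedSpace.exp (r • J) := by
  have h1 : r • (J - 1) = algebraMap ℝ (E →L[ℝ] E) (-r) + r • J := by
    rw [Algebra.algebraMap_eq_smul_one]; module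
  have h2 : Commute (algebraMap ℝ (E →L[ℝ] E) (-r)) (r • J) := Algebra.commutes _ _
  let _ : NormedAlgebra ℚ (E →L[ℝ] E) := NormedAlgebra.restrictScalars ℚ ℝ (E →L[ℝ] E)
  rw [h1, exp_add_of_commute h2, ← algebraMap_exp_comm, ← Real.exp_eq_exp_ℝ, ← Algebra.smul_def]

theorem norm_exp_smul_sub_one_apply_le {J : E →L[ℝ] E} (hJ : ‖J‖ ≤ 1) {r : ℝ} (hr : 0 ≤ r)
    (x : E) : ‖NormedSpace.exp (r • (J - 1)) x‖ ≤ ‖x‖ := by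
  have hx : HasSum (fun n : ℕ => Real.exp (-r) • ((n.factorial : ℝ)⁻¹ • (r • J) ^ n) x)
      (NormedSpace.exp (r • (J - 1)) x) := by
    rw [exp_smul_sub_one]
    exact ((ContinuousLinearMap.apply ℝ E x).hasSum (exp_series_hasSum_exp' (𝕂 := ℝ) (r • J))).const_smul
      (Real.exp (-r))
  have hb : HasSum (fun n : ℕ => Real.exp (-r) * (((n.factorial : ℝ)⁻¹ • r ^ n) * ‖x‖)) ‖x‖ := by
    have h3 := ((exp_series_hasSum_exp' (𝕂 := ℝ) r).mul_right ‖x‖).mul_left (Real.exp (-r))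
    rwa [← Real.exp_eq_exp_ℝ, ← mul_assoc, ← Real.exp_add, neg_add_cancel, Real.exp_zero,
      one_mul] at h3
  refine hx.norm_le_of_bounded hb fun n => ?_
  have hn : ‖(J ^ n) x‖ ≤ ‖x‖ := by
    induction n with
    | zero => simp
    | succ n ih =>
      rw [pow_succ', mul_apply_eq_comp]
      have := J.le_of_opNorm_le hJ ((J ^ n) x)
      linarith
  rw [smul_pow, smul_apply, smul_apply, norm_smul, norm_smul, norm_smul,
    Real.norm_of_nonneg (Real.exp_pos _).le, Real.norm_of_nonneg (by positivity),
    Real.norm_of_nonneg (by positivity), smul_eq_mul, mul_assoc]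
  gcongr

end NormedSpace

/-! ### Contraction semigroups and the rate of the Yosida approximation. -/

namespace ContractionSemigroup

open LinearPMap

variable {H : Type*} [NormedAddCommGroup H] [InnerProductSpace ℝ H]

theorem norm_op_apply_le (S : ContractionSemigroup H) (t : ℝ≥0) (x : H) : ‖S.op t x‖ ≤ ‖x‖ := by
  simpa using (S.op t).le_of_opNorm_le (S.norm_op_le t) x

theorem op_comm (S : ContractionSemigroup H) (s t : ℝ≥0) (x : H) :
    S.op s (S.op t x) = S.op t (S.op s x) := by
  have h1 := congrArg (fun U => U x) (S.op_add s t)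
  have h2 := congrArg (fun U => U x) (S.op_add t s)
  rw [add_comm] at h2
  exact h1.symm.trans h2

theorem growthBoundOn_iff {S : ContractionSemigroup H} {T : H →ₗ.[ℝ] H} {α : ℝ} :
    S.GrowthBoundOn T α ↔ ∀ t : ℝ≥0, Scales T (S.op t) (Real.exp (α * t)) := by
  constructor
  · rintro h t a x ⟨y, hxy, hya⟩
    obtain ⟨φ, rfl, rfl⟩ := (mem_graph_iff _).1 hxy
    obtain ⟨h1, h2⟩ := h φ t
    exact ⟨_, T.mem_graph ⟨_, h1⟩, h2.trans (by gcongr)⟩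
  · intro h φ t
    obtain ⟨y, hy, hya⟩ := h t (a := ‖T φ‖) ⟨_, T.mem_graph φ, le_rfl⟩
    have hd := mem_domain_of_mem_graph hy
    refine ⟨hd, ?_⟩
    rwa [← T.mem_graph_snd_inj hy (T.mem_graph ⟨_, hd⟩) rfl]

theorem _root_.Real.tendsto_toNNReal_nhdsGT_zero :
    Tendsto Real.toNNReal (𝓝[>] 0) (𝓝[>] 0) := by
  refine tendsto_nhdsWithin_iff.2 ⟨?_, ?_⟩
  · have := continuous_real_toNNReal.tendsto 0
    rw [Real.toNNReal_zero] at this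
    exact this.mono_left nhdsWithin_le_nhds
  · filter_upwards [self_mem_nhdsWithin] with h hh
    exact Real.toNNReal_pos.2 hh

section Generator

variable {S : ContractionSemigroup H} {B : H →ₗ.[ℝ] H} {x y : H}

theorem HasGenerator.tendsto (hS : S.HasGenerator (-B)) (hxy : (x, y) ∈ B.graph) :
    Tendsto (fun h : ℝ => h⁻¹ • (S.op h.toNNReal x - x)) (𝓝[>] 0) (𝓝 (-y)) := by
  have h1 := (hS x (-y)).1 (mem_graph_neg.2 (by rwa [neg_neg]))
  refine (h1.comp Real.tendsto_toNNReal_nhdsGT_zero).congr' ?_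
  filter_upwards [self_mem_nhdsWithin] with h hh
  simp [Real.coe_toNNReal h (le_of_lt hh)]

theorem HasGenerator.op_mem_graph (hS : S.HasGenerator (-B)) (hxy : (x, y) ∈ B.graph)
    (t : ℝ≥0) : (S.op t x, S.op t y) ∈ B.graph := by
  have h1 := (hS x (-y)).1 (mem_graph_neg.2 (by rwa [neg_neg]))
  have h2 : (S.op t x, -S.op t y) ∈ (-B).graph := by
    refine (hS _ _).2 ?_
    have h3 := ((S.op t).continuous.tendsto (-y)).comp h1
    rw [_root_.map_neg] at h3
    refine h3.congr fun h => ?_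
    simp only [Function.comp_apply]
    rw [_root_.map_smul, _root_.map_sub, S.op_comm]
  simpa using mem_graph_neg.1 h2

theorem HasGenerator.hasDerivWithinAt (hS : S.HasGenerator (-B)) (hxy : (x, y) ∈ B.graph) {s : ℝ}
    (hs : 0 ≤ s) : HasDerivWithinAt (fun s : ℝ => S.op s.toNNReal x) (-S.op s.toNNReal y)
      (Set.Ici s) s := by
  rw [hasDerivWithinAt_iff_tendsto_slope, Set.Ici_sdiff_left]
  have h1 := hS.tendsto (hS.op_mem_graph hxy s.toNNReal)
  have h2 : Tendsto (fun r : ℝ => r - s) (𝓝[>] s) (𝓝[>] 0) := by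
    refine tendsto_nhdsWithin_iff.2 ⟨?_, ?_⟩
    · exact ((continuous_sub_right s).tendsto' _ _ (sub_self s)).mono_left nhdsWithin_le_nhds
    · filter_upwards [self_mem_nhdsWithin] with r hr using sub_pos.2 (Set.mem_Ioi.1 hr)
  refine (h1.comp h2).congr' ?_
  filter_upwards [self_mem_nhdsWithin] with r hr
  have hr : s < r := hr
  have h3 : r.toNNReal = (r - s).toNNReal + s.toNNReal := by
    rw [← Real.toNNReal_add (sub_pos.2 hr).le hs, sub_add_cancel]
  simp only [Function.comp_apply, slope_def_module]
  rw [h3, S.op_add]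
  rfl

/-- The resolvents of the generator commute with the semigroup. -/
theorem HasGenerator.resolvent_comm (hS : S.HasGenerator (-B)) {l : ℝ} (hl : l ≠ 0)
    {J : H →L[ℝ] H} (hJ : IsResolvent B l J) (t : ℝ≥0) (z : H) :
    J (S.op t z) = S.op t (J z) := by
  have h1 := hJ.apply_add (hS.op_mem_graph (hJ.mem_graph z) t)
  rw [← h1, ← _root_.map_smul, ← _root_.map_add, smul_smul, mul_inv_cancel₀ hl, one_smul,
    add_sub_cancel]

/-- Convergence rate of the Yosida approximation. -/
theorem HasGenerator.norm_sub_exp_le [CompleteSpace H] (hS : S.HasGenerator (-B)) {l : ℝ}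
    (hl : 0 < l) {J : H →L[ℝ] H} (hJ : IsResolvent B l J) (hxy : (x, y) ∈ B.graph) (t : ℝ≥0) :
    ‖S.op t x - NormedSpace.exp (((t : ℝ) / l) • (J - 1)) x‖ ≤ ‖J y - y‖ * t := by
  set Y : H →L[ℝ] H := l⁻¹ • (J - 1) with hY
  have hYe : ∀ s : ℝ, s • Y = (s / l) • (J - 1) := fun s => by
    rw [hY, smul_smul, div_eq_mul_inv]
  -- `F` runs from `exp (tY) x` to `S(t) x`. Since `Y x = -J y`, its right derivative is `exp ((t -
  -- s)Y) S(s) (J y - y)`, of norm at most `‖J y - y‖`.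
  let F : ℝ → H := fun s => NormedSpace.exp ((t - s) • Y) (S.op s.toNNReal x)
  have hE : ∀ s : ℝ, HasDerivAt (fun s : ℝ => NormedSpace.exp (((t : ℝ) - s) • Y))
      (-(NormedSpace.exp (((t : ℝ) - s) • Y) * Y)) s := fun s => by
    have := (hasDerivAt_exp_smul_const (𝕂 := ℝ) Y ((t : ℝ) - s)).scomp s
      ((hasDerivAt_id s).const_sub (t : ℝ))
    simpa [Function.comp_def] using this
  have hF : ∀ s ∈ Set.Ico (0 : ℝ) t, HasDerivWithinAt F
      (NormedSpace.exp (((t : ℝ) - s) • Y) (S.op s.toNNReal (J y - y))) (Set.Ici s) s := by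
    intro s hs
    have h1 := (hE s).hasDerivWithinAt.clm_apply (hS.hasDerivWithinAt hxy hs.1)
    convert h1 using 1
    have h2 : Y (S.op s.toNNReal x) = -S.op s.toNNReal (J y) := by
      have h3 := hJ.sub_apply (hS.op_mem_graph hxy s.toNNReal)
      rw [hS.resolvent_comm hl.ne' hJ _ y] at h3
      change l⁻¹ • (J (S.op s.toNNReal x) - S.op s.toNNReal x) = _
      rw [← neg_sub, h3, smul_neg, smul_smul, inv_mul_cancel₀ hl.ne', one_smul]
    rw [_root_.neg_apply, mul_apply_eq_comp, h2]
    simp only [_root_.map_neg, _root_.map_sub, neg_neg]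
    abel
  have hcont : ContinuousOn F (Set.Icc 0 t) := by
    have h1 : Continuous fun s : ℝ => NormedSpace.exp (((t : ℝ) - s) • Y) :=
      continuous_iff_continuousAt.2 fun s => (hE s).continuousAt
    exact (h1.clm_apply ((S.continuous_orbit x).comp continuous_real_toNNReal)).continuousOn
  have hbound : ∀ s ∈ Set.Ico (0 : ℝ) t,
      ‖NormedSpace.exp (((t : ℝ) - s) • Y) (S.op s.toNNReal (J y - y))‖ ≤ ‖J y - y‖ := by
    intro s hs
    rw [hYe]
    exact (NormedSpace.norm_exp_smul_sub_one_apply_le hJ.norm_le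
      (div_nonneg (sub_nonneg.2 hs.2.le) hl.le) _).trans (S.norm_op_apply_le _ _)
  have := norm_image_sub_le_of_norm_deriv_right_le_segment hcont hF hbound t
    ⟨t.coe_nonneg, le_rfl⟩
  simpa [F, hYe, S.op_zero] using this

end Generator

end ContractionSemigroup

/-! ### From resolvent bounds to semigroup bounds; the product formula step. -/

namespace LinearPMap

variable {H : Type*} [NormedAddCommGroup H] [InnerProductSpace ℝ H] [CompleteSpace H]

/-- The `n`-th Poisson term scales by `r ^ n`, and `∑ e^{-c} c^n r^n / n! = e^{c (r - 1)}`. -/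
theorem Scales.exp_smul_sub_one {T : H →ₗ.[ℝ] H} (hT : ∀ a, _root_.IsClosed (T.sublevel a))
    {J : H →L[ℝ] H} {r : ℝ} (hJ : Scales T J r) {c : ℝ} (hc : 0 ≤ c) :
    Scales T (NormedSpace.exp (c • (J - 1)) : H →L[ℝ] H) (Real.exp (c * (r - 1))) := by
  intro a x hx
  have h1 : HasSum (fun n : ℕ => Real.exp (-c) • ((n.factorial : ℝ)⁻¹ • (c • J) ^ n) x)
      (NormedSpace.exp (c • (J - 1)) x) := by
    rw [NormedSpace.exp_smul_sub_one]
    exact ((ContinuousLinearMap.apply ℝ H x).hasSum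
      (NormedSpace.exp_series_hasSum_exp' (𝕂 := ℝ) (c • J))).const_smul (Real.exp (-c))
  have h2 : HasSum (fun n : ℕ => Real.exp (-c) * (((n.factorial : ℝ)⁻¹ • (c * r) ^ n) * a))
      (Real.exp (c * (r - 1)) * a) := by
    have h3 := ((NormedSpace.exp_series_hasSum_exp' (𝕂 := ℝ) (c * r)).mul_right a).mul_left
      (Real.exp (-c))
    rw [← Real.exp_eq_exp_ℝ, ← mul_assoc, ← Real.exp_add] at h3
    rwa [show -c + c * r = c * (r - 1) by ring] at h3
  refine hasSum_mem_sublevel hT (fun n => ?_) h1 h2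
  refine smul_mem_sublevel (Real.exp_pos _).le ?_
  rw [_root_.smul_pow, _root_.mul_pow, _root_.smul_apply, _root_.smul_apply, smul_eq_mul, mul_assoc,
    mul_assoc]
  exact smul_mem_sublevel (by positivity)
    (smul_mem_sublevel (pow_nonneg hc n) (hJ.pow n hx))

/-- If `u` is orthogonal to the domain, `(0, u)` is monotonically related to the graph, so `u = B 0
= 0`. -/
theorem IsMaximalMonotone.dense_domain {B : H →ₗ.[ℝ] H} (hB : B.IsMaximalMonotone) :
    Dense (B.domain : Set H) := by
  rw [Submodule.dense_iff_topologicalClosure_eq_top, Submodule.topologicalClosure_eq_top_iff,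
    Submodule.eq_bot_iff]
  intro u hu
  have h0 : ((0 : H), u) ∈ B.graph := by
    refine hB.mem_graph fun x y hxy => ?_
    have h1 := (Submodule.mem_orthogonal _ _).1 hu x (mem_domain_of_mem_graph hxy)
    have h2 := hB.1.inner_nonneg hxy
    rw [zero_sub, inner_neg_left, inner_sub_right, h1]
    linarith
  exact B.graph_fst_eq_zero_snd h0 rfl

/-- On the domain `‖x - J x‖ = l ‖J (B x)‖ ≤ l ‖B x‖`; density and contractivity give the rest. -/
theorem IsMaximalMonotone.tendsto_resolvent {B : H →ₗ.[ℝ] H} (hB : B.IsMaximalMonotone)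
    {J : ℝ → H →L[ℝ] H} (hJ : ∀ l, 0 < l → IsResolvent B l (J l)) (z : H) :
    Tendsto (fun l => J l z) (𝓝[>] 0) (𝓝 z) := by
  rw [Metric.tendsto_nhds]
  intro e he
  obtain ⟨x, hx, hxz⟩ := hB.dense_domain.exists_dist_lt z (ε := e / 3) (by positivity)
  obtain ⟨y, hxy⟩ := mem_domain_iff.1 hx
  have hlim : Tendsto (fun l : ℝ => l * ‖y‖) (𝓝[>] 0) (𝓝 0) :=
    ((continuous_mul_const _).tendsto' _ _ (zero_mul _)).mono_left nhdsWithin_le_nhds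
  filter_upwards [hlim.eventually_lt_const (show 0 < e / 3 by positivity), self_mem_nhdsWithin]
    with l h1 h2
  have h2 : 0 < l := h2
  have hl := hJ l h2
  have h3 : ‖J l x - x‖ ≤ l * ‖y‖ := by
    rw [← norm_neg, neg_sub, hl.sub_apply hxy, norm_smul, Real.norm_of_nonneg h2.le]
    have := hl.norm_apply_le y
    gcongr
  have h4 : ‖J l (z - x)‖ ≤ ‖z - x‖ := hl.norm_apply_le _
  rw [dist_eq_norm] at hxz ⊢
  have h5 : J l z - z = J l (z - x) + (J l x - x) - (z - x) := by
    rw [_root_.map_sub]; abel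
  rw [h5]
  have h6 := norm_sub_le (J l (z - x) + (J l x - x)) (z - x)
  have h7 := norm_add_le (J l (z - x)) (J l x - x)
  linarith

/-- Growth bounds for the resolvents of the generator pass to the semigroup. -/
theorem IsMaximalMonotone.growthBoundOn_of_resolvent {T B : H →ₗ.[ℝ] H}
    (hT : ∀ a, _root_.IsClosed (T.sublevel a)) (hB : B.IsMaximalMonotone)
    {S : ContractionSemigroup H} (hS : S.HasGenerator (-B)) {α : ℝ}
    (hα : ∀ (l : ℝ) (J : H →L[ℝ] H), 0 < l → l * α < 1 → IsResolvent B l J →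
      Scales T J (1 - l * α)⁻¹) : S.GrowthBoundOn T α := by
  rw [ContractionSemigroup.growthBoundOn_iff]
  intro t a z hz
  have hex : ∀ l : ℝ, ∃ J : H →L[ℝ] H, 0 < l → IsResolvent B l J := fun l => by
    by_cases hl : 0 < l
    · exact (hB.exists_isResolvent hl).imp fun J hJ _ => hJ
    · exact ⟨0, fun h => absurd h hl⟩
  choose J hJ using hex
  have hl0 : Tendsto (fun l : ℝ => l * α) (𝓝[>] 0) (𝓝 0) :=
    ((continuous_mul_const _).tendsto' _ _ (zero_mul _)).mono_left nhdsWithin_le_nhds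
  have hlα : ∀ᶠ l : ℝ in 𝓝[>] 0, l * α < 1 := hl0.eventually_lt_const one_pos
  -- The rate `norm_sub_exp_le` covers the dense domain; contractivity on both sides extends the
  -- limit to `z`.
  have hlim : Tendsto (fun l : ℝ => NormedSpace.exp (((t : ℝ) / l) • (J l - 1)) z) (𝓝[>] 0)
      (𝓝 (S.op t z)) := by
    rw [Metric.tendsto_nhds]
    intro e he
    obtain ⟨x, hx, hxz⟩ := hB.dense_domain.exists_dist_lt z (ε := e / 3) (by positivity)
    obtain ⟨y, hxy⟩ := mem_domain_iff.1 hx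
    have h1 : Tendsto (fun l => ‖J l y - y‖ * t) (𝓝[>] 0) (𝓝 0) := by
      have := (((hB.tendsto_resolvent hJ y).sub_const y).norm).mul_const (t : ℝ)
      simpa using this
    filter_upwards [h1.eventually_lt_const (show 0 < e / 3 by positivity), self_mem_nhdsWithin]
      with l h2 h3
    have h3 : 0 < l := h3
    have h4 := hS.norm_sub_exp_le h3 (hJ l h3) hxy t
    set E : H →L[ℝ] H := NormedSpace.exp (((t : ℝ) / l) • (J l - 1))
    have h5 : ‖E (z - x)‖ ≤ ‖z - x‖ :=
      NormedSpace.norm_exp_smul_sub_one_apply_le (hJ l h3).norm_le (by positivity) _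
    have h6 := S.norm_op_apply_le t (z - x)
    rw [dist_eq_norm] at hxz ⊢
    have h7 : E z - S.op t z = E (z - x) - (S.op t x - E x) - S.op t (z - x) := by
      rw [_root_.map_sub, _root_.map_sub]; abel
    rw [h7]
    have h8 := norm_sub_le (E (z - x) - (S.op t x - E x)) (S.op t (z - x))
    have h9 := norm_sub_le (E (z - x)) (S.op t x - E x)
    linarith
  refine mem_sublevel_of_tendsto hT
    (b := fun l => Real.exp ((t : ℝ) / l * ((1 - l * α)⁻¹ - 1)) * a) ?_ hlim ?_
  · filter_upwards [hlα, self_mem_nhdsWithin] with l h1 h2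
    have h2 : 0 < l := h2
    exact (hα l (J l) h2 h1 (hJ l h2)).exp_smul_sub_one hT (by positivity) hz
  -- The exponent equals `α t (1 - lα)⁻¹`, which tends to `α t`.
  · refine Tendsto.mul_const a ((Real.continuous_exp.tendsto _).comp ?_)
    have h1 : Tendsto (fun l : ℝ => α * t * (1 - l * α)⁻¹) (𝓝[>] 0) (𝓝 (α * t)) := by
      simpa using ((hl0.const_sub 1).inv₀ (by norm_num)).const_mul (α * t)
    refine h1.congr' ?_
    filter_upwards [hlα, self_mem_nhdsWithin] with l h2 h3
    have h3 : 0 < l := h3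
    have h4 : 1 - l * α ≠ 0 := by linarith
    have h5 : (1 - l * α)⁻¹ - 1 = l * α * (1 - l * α)⁻¹ := by
      nth_rw 2 [← mul_inv_cancel₀ h4]
      ring
    rw [h5]
    have h6 : (t : ℝ) / l * l = t := div_mul_cancel₀ _ h3.ne'
    linear_combination (-α * (1 - l * α)⁻¹) * h6

/-- One step of the product formula for `A + ε G`: the operators `S_A(h) (1 + h ε G)⁻¹` are
tangent to `-(A + ε G)` at `h = 0`. -/
theorem tendsto_op_resolvent {A G : H →ₗ.[ℝ] H} (hG : G.IsMaximalMonotone) {S : ContractionSemigroup H}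
    (hS : S.HasGenerator (-A)) {ε : ℝ} (hε : 0 < ε) {J : ℝ → H →L[ℝ] H}
    (hJ : ∀ l, 0 < l → IsResolvent G l (J l)) {x y : H} (hxy : (x, y) ∈ (A + ε • G).graph) :
    Tendsto (fun h : ℝ => h⁻¹ • (S.op h.toNNReal (J (ε * h) x) - x)) (𝓝[>] 0) (𝓝 (-y)) := by
  obtain ⟨a, b, ha, hb, rfl⟩ := exists_of_mem_graph_add hxy
  obtain ⟨g, hg, rfl⟩ := exists_of_mem_graph_smul hb
  have hεh : Tendsto (fun h : ℝ => ε * h) (𝓝[>] 0) (𝓝[>] 0) := by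
    refine tendsto_nhdsWithin_iff.2 ⟨?_, ?_⟩
    · exact ((continuous_const_mul ε).tendsto' _ _ (mul_zero _)).mono_left nhdsWithin_le_nhds
    · filter_upwards [self_mem_nhdsWithin] with h hh using mul_pos hε hh
  have h1 := hS.tendsto ha
  have h2 : Tendsto (fun h : ℝ => J (ε * h) g) (𝓝[>] 0) (𝓝 g) :=
    (hG.tendsto_resolvent hJ g).comp hεh
  have h3 : Tendsto (fun h : ℝ => S.op h.toNNReal (J (ε * h) g)) (𝓝[>] 0) (𝓝 g) := by
    have h4 : Tendsto (fun h : ℝ => S.op h.toNNReal g) (𝓝[>] 0) (𝓝 g) := by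
      have : Continuous fun h : ℝ => S.op h.toNNReal g :=
        (S.continuous_orbit g).comp continuous_real_toNNReal
      exact (this.tendsto' _ _ (by simp [S.op_zero])).mono_left nhdsWithin_le_nhds
    have h5 : Tendsto (fun h : ℝ => S.op h.toNNReal (J (ε * h) g - g)) (𝓝[>] 0) (𝓝 0) := by
      have h6 : Tendsto (fun h : ℝ => ‖J (ε * h) g - g‖) (𝓝[>] 0) (𝓝 0) := by
        simpa using (h2.sub_const g).norm
      exact squeeze_zero_norm (fun h => S.norm_op_apply_le _ _) h6
    simpa using h5.add h4
  -- Since `x - J x = εh J g`, the quotient splits as `h⁻¹ (S(h) x - x) - ε S(h) J g`.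
  have h7 := h1.sub (h3.const_smul ε)
  rw [neg_add, ← sub_eq_add_neg]
  refine h7.congr' ?_
  filter_upwards [self_mem_nhdsWithin] with h hh
  have hh : 0 < h := hh
  have h8 := (hJ (ε * h) (mul_pos hε hh)).sub_apply hg
  have h9 : J (ε * h) x = x - (ε * h) • J (ε * h) g := by rw [← h8]; abel
  have h10 : ε = h⁻¹ * (ε * h) := by field_simp
  rw [h9, _root_.map_sub, _root_.map_smul]
  nth_rw 1 [h10]
  module

end LinearPMap


/-! ### The growth bounds for `A + εG`. -/

theorem mainTheorem6 {H : Type*} [NormedAddCommGroup H] [InnerProductSpace ℝ H] [CompleteSpace H]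
    (A G : H →ₗ.[ℝ] H) (hA : A.IsMaximalMonotone) (hG : G.IsMaximalMonotone)
    (ε₀ : ℝ) (hε₀ : 0 < ε₀)
    (hAG : ∀ ε : ℝ, 0 < ε → ε ≤ ε₀ → (A + ε • G).closure.IsMaximalMonotone)
    (SA : ContractionSemigroup H) (hSA : SA.HasGenerator (-A))
    (m : ℕ) (hm : 1 ≤ m) (α : ℕ → ℝ)
    (hα : ∀ k : ℕ, 1 ≤ k → k ≤ m + 1 → SA.GrowthBoundOn (G.iter k) (α k))
    (ε : ℝ) (hε : 0 < ε) (hεε₀ : ε ≤ ε₀)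
    (S : ContractionSemigroup H) (hS : S.HasGenerator (-(A + ε • G).closure)) :
    ∀ k : ℕ, 1 ≤ k → k ≤ m + 1 → S.GrowthBoundOn (G.iter k) (α k) := by
  intro k hk hkm
  have hT := hG.isClosed_sublevel_iter k
  have hex : ∀ l : ℝ, ∃ J : H →L[ℝ] H, 0 < l → G.IsResolvent l J := fun l => by
    by_cases hl : 0 < l
    · exact (hG.exists_isResolvent hl).imp fun J hJ _ => hJ
    · exact ⟨0, fun h => absurd h hl⟩
  choose J hJ using hex
  refine (hAG ε hε hεε₀).growthBoundOn_of_resolvent hT hS fun l R hl hlα hR => ?_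
  refine hR.scales_of_tangent hT (V := fun h => (SA.op h.toNNReal).comp (J (ε * h)))
    (fun h hh => ?_) (fun h hh => ?_) (fun x y hxy => ?_) hl hlα
  · exact ContinuousLinearMap.opNorm_le_bound _ zero_le_one fun x => by
      rw [one_mul]
      exact (SA.norm_op_apply_le _ _).trans ((hJ _ (mul_pos hε hh)).norm_apply_le x)
  -- The factor `e^{αh}` comes from `S_A(h)` alone; the resolvent of `G` contributes `1`.
  · have h1 := (ContractionSemigroup.growthBoundOn_iff.1 (hα k hk hkm) h.toNNReal).comp
      ((hJ _ (mul_pos hε hh)).scales_iter (mul_pos hε hh).ne' k)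
    rwa [mul_one, Real.coe_toNNReal h hh.le] at h1
  · exact LinearPMap.tendsto_op_resolvent hG hSA hε hJ hxy
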